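/- Herman's algorithm runs on a ring of $N\ge 1$ processors, each of which holds at most one token, the number of tokens being odd. At each time step, simultaneously, each processor that holds a token independently keeps it or passes it to the next processor in the ring, with probability $\frac12$ each; if a kept token and a received token meet at a processor, both are annihilated. A state is stable if exactly one token is left, and the stabilisation time $T$ is the first time at which the state is stable. A time step that begins in a state with $m$ tokens has cost $\frac{m-1}{2}$, and the total cost $C$ is the sum of the costs of all time steps. Let the algorithm start from any state with $2s+1$ tokens ($s\ge 0$). Then \[ \mathbb{E}(C)\le\left(1-\frac{1}{(2s+1)^{2}}\right)\frac{N^2}{6}. \] Moreover $T\le C$ almost surely, and consequently $\mathbb{E}(T)\le \frac{N^2}{6}$. -/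

import Mathlib

open MeasureTheory
open scoped ENNReal

namespace Herman

/-- A state of a ring of `N` processors, labelled by `ZMod N` so that the successor of processor
`p` is `p + 1`: the set of processors that hold a token. -/
abbrev State (N : ℕ) : Type := Finset (ZMod N)

/-- The state reached from `A` when the tokens at the positions in `M` (a subset of `A`) are passed
to the next processor and the others are kept: two tokens that meet at a processor annihilate. -/
def move {N : ℕ} (A M : State N) : State N :=
  symmDiff (A \ M) (M.image (fun p => p + 1))

/-- The one-step law of Herman's algorithm from the state `A`: each processor that has a token
independently keeps it or passes it on, with probability `1 / 2` each, which means that the set `M`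
of tokens that are passed on is uniformly distributed among the subsets of `A`. -/
noncomputable def step {N : ℕ} (A : State N) : PMF (State N) :=
  (PMF.uniformOfFinset A.powerset ⟨∅, Finset.empty_mem_powerset A⟩).map (move A)

/-- The random states `A 0, A 1, …` on the probability space `(Ω, μ)` form a run of Herman's
algorithm from the state `A₀`: a Markov chain started at `A₀` with one-step law `step`. -/
structure IsRun {N : ℕ} {Ω : Type*} [MeasurableSpace Ω] (μ : Measure Ω)
    (A₀ : State N) (A : ℕ → Ω → State N) : Prop where
  measurable : ∀ (t : ℕ) (x : State N), MeasurableSet {ω | A t ω = x}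
  start : ∀ᵐ ω ∂μ, A 0 ω = A₀
  law : ∀ (t : ℕ) (x : ℕ → State N),
    μ {ω | ∀ i ≤ t + 1, A i ω = x i} =
      μ {ω | ∀ i ≤ t, A i ω = x i} * step (x t) (x (t + 1))

/-- The cost `(m - 1) / 2` of a time step that begins in a state with `m` tokens. (A run from a
state with an odd number of tokens almost surely has `m` odd, so `1 ≤ m`, at all times.) -/
noncomputable def stepCost {N : ℕ} (A : State N) : ℝ≥0∞ :=
  ((A.card : ℝ≥0∞) - 1) / 2

/-- The total cost of a sequence of states, in `[0, ∞]`. -/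
noncomputable def totalCost {N : ℕ} (A : ℕ → State N) : ℝ≥0∞ :=
  ∑' t, stepCost (A t)

/-- The stabilisation time: the first time at which there is exactly one token
(`∞` if there is no such time). -/
noncomputable def stabTime {N : ℕ} (A : ℕ → State N) : ℝ≥0∞ :=
  ⨅ (t : ℕ) (_ : (A t).card = 1), (t : ℝ≥0∞)

end Herman

namespace Herman

/-! ### Autocorrelations of antiperiodic sign sequences -/

open Finset

/-! Walk around the ring with a sign σ that flips at every token. As the number m of tokens is odd,
σ is antiperiodic. A step replaces each spin, in the mean, by the average of two neighbouring spins,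
and distinct processors decide independently. Hence the autocorrelation R(d), 0 < d < N, obeys a
discrete heat equation in the mean (`sum_powerset_autocorr`), with fixed boundary values R(0) = N
and R(N) = -N.

The affine weights N - 2d reduce the sum of second differences to boundary terms, so W = Σ (N - 2d)
R(d) grows in the mean by exactly N(m - 1), and `potential`, affine in W, drops by exactly the step
cost (`sum_powerset_potential`). The potential is nonnegative by `weightedCorr_le`, so telescoping
bounds E(C) by its initial value. That value is bounded by `le_weightedCorr`, where W is read off
from the L² norm of the antiperiodic primitive of σ: few sign changes force this norm to be large.

Finally, T ≤ C because an odd m ≠ 1 is at least 3, so every unstable step costs at least 1. -/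

theorem sum_range_add_of_periodic {N : ℕ} {g : ℕ → ℝ} (hg : ∀ n, g (n + N) = g n) (d : ℕ) :
    ∑ p ∈ range N, g (p + d) = ∑ p ∈ range N, g p := by
  induction d with
  | zero => simp
  | succ d ih =>
    rw [← ih]
    have h1 := Finset.sum_range_succ (fun p => g (p + d)) N
    have h2 := Finset.sum_range_succ' (fun p => g (p + d)) N
    have h3 : g (N + d) = g (0 + d) := by rw [add_comm N d, hg, zero_add]
    have h4 : ∑ p ∈ range N, g (p + (d + 1)) = ∑ p ∈ range N, g (p + 1 + d) :=
      Finset.sum_congr rfl fun p _ => by congr 1; ring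
    linarith

/-- The autocorrelation at distance `d` of a sequence over one period `N`. -/
def autocorr (N : ℕ) (σ : ℕ → ℝ) (d : ℕ) : ℝ :=
  ∑ p ∈ range N, σ p * σ (p + d)

/-- The autocorrelations at the distances `0 < d < N`, summed with the weights `N - 2 * d`. -/
def weightedCorr (N : ℕ) (σ : ℕ → ℝ) : ℝ :=
  ∑ e ∈ range (N - 1), ((N : ℝ) - 2 * ((e : ℝ) + 1)) * autocorr N σ (e + 1)

/-- A sequence of signs that is antiperiodic with antiperiod `N`. -/
structure IsTwistedSign (N : ℕ) (σ : ℕ → ℝ) : Prop where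
  sign : ∀ n, σ n = 1 ∨ σ n = -1
  anti : ∀ n, σ (n + N) = -σ n

namespace IsTwistedSign

variable {N : ℕ} {σ : ℕ → ℝ}

theorem mul_self (h : IsTwistedSign N σ) (n : ℕ) : σ n * σ n = 1 := by
  rcases h.sign n with h | h <;> rw [h] <;> norm_num

theorem sum_shift (h : IsTwistedSign N σ) (a d : ℕ) :
    ∑ p ∈ range N, σ (p + a) * σ (p + a + d) = autocorr N σ d := by
  refine sum_range_add_of_periodic (g := fun p => σ p * σ (p + d)) (fun n => ?_) a
  rw [add_right_comm n N d, h.anti, h.anti, neg_mul_neg]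

theorem autocorr_zero (h : IsTwistedSign N σ) : autocorr N σ 0 = N := by
  simp [autocorr, h.mul_self]

theorem autocorr_reflect (h : IsTwistedSign N σ) {d e : ℕ} (hde : d + e = N) :
    autocorr N σ e = -autocorr N σ d := by
  rw [← h.sum_shift d e, autocorr, ← Finset.sum_neg_distrib]
  refine Finset.sum_congr rfl fun p _ => ?_
  rw [add_assoc p d e, hde, h.anti]
  ring

theorem sum_autocorr (h : IsTwistedSign N σ) :
    ∑ e ∈ range (N - 1), autocorr N σ (e + 1) = 0 := by
  have h1 := Finset.sum_range_reflect (fun e => autocorr N σ (e + 1)) (N - 1)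
  have h2 : ∑ e ∈ range (N - 1), autocorr N σ (N - 1 - 1 - e + 1) =
      ∑ e ∈ range (N - 1), -autocorr N σ (e + 1) :=
    Finset.sum_congr rfl fun e he => h.autocorr_reflect (by have := mem_range.1 he; omega)
  rw [h2, Finset.sum_neg_distrib] at h1
  linarith

end IsTwistedSign

/-! ### Summation identities and the clamped cubic -/

theorem sum_range_reflect_succ (R : ℕ → ℝ) (n : ℕ) :
    ∑ q ∈ range n, R (n - q) = ∑ q ∈ range n, R (q + 1) := by
  rw [← Finset.sum_range_reflect (fun q => R (q + 1)) n]
  refine Finset.sum_congr rfl fun q hq => ?_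
  have := mem_range.1 hq
  congr 1
  omega

theorem sum_triangle (c : ℝ) (R : ℕ → ℝ) (n : ℕ) :
    ∑ r ∈ range n, ∑ q ∈ range r, (c - R (q + 1) + R (r + 1) - R (r - q)) =
      c * n * (n - 1) / 2 + ∑ e ∈ range n, (3 * (e : ℝ) + 2 - 2 * n) * R (e + 1) := by
  induction n with
  | zero => simp
  | succ n ih =>
    rw [Finset.sum_range_succ, ih, Finset.sum_range_succ]
    simp only [Finset.sum_add_distrib, Finset.sum_sub_distrib, Finset.sum_const, card_range,
      nsmul_eq_mul, sum_range_reflect_succ R n]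
    have h1 : ∑ e ∈ range n, (3 * (e : ℝ) + 2 - 2 * ((n + 1 : ℕ) : ℝ)) * R (e + 1) =
        ∑ e ∈ range n, (3 * (e : ℝ) + 2 - 2 * n) * R (e + 1) - 2 * ∑ e ∈ range n, R (e + 1) := by
      rw [Finset.mul_sum, ← Finset.sum_sub_distrib]
      exact Finset.sum_congr rfl fun e _ => by push_cast; ring
    rw [h1]
    push_cast
    ring

/-- Summation by parts: the hypothesis makes `w` affine, so only boundary terms survive. -/
theorem sum_secondDiff (w R : ℕ → ℝ) (hw : ∀ e, w (e + 2) = 2 * w (e + 1) - w e) (n : ℕ) :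
    ∑ e ∈ range n, w (e + 1) * (R e + R (e + 2) - 2 * R (e + 1)) =
      w n * R (n + 1) - w (n + 1) * R n - w 0 * R 1 + w 1 * R 0 := by
  induction n with
  | zero => simp
  | succ n ih =>
    rw [Finset.sum_range_succ, ih, hw n]
    ring

/-- The cubic `b ^ 2 * x - x ^ 3 / 3`, made constant outside its increasing range `[-b, b]`. -/
noncomputable def clampedCubic (b x : ℝ) : ℝ :=
  b ^ 2 * max (-b) (min b x) - (max (-b) (min b x)) ^ 3 / 3

theorem clampedCubic_neg {b : ℝ} (hb : 0 ≤ b) (x : ℝ) :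
    clampedCubic b (-x) = -clampedCubic b x := by
  have h : max (-b) (min b (-x)) = -max (-b) (min b x) := by
    rcases le_total b x with h | h <;> rcases le_total (-b) x with h' | h'
    all_goals
      simp only [max_def, min_def]
      split_ifs <;> linarith
  rw [clampedCubic, clampedCubic, h]
  ring

theorem abs_clampedCubic_le {b : ℝ} (hb : 0 ≤ b) (x : ℝ) :
    |clampedCubic b x| ≤ 2 * b ^ 3 / 3 := by
  rw [clampedCubic]
  have h1 : -b ≤ max (-b) (min b x) := le_max_left _ _
  have h2 : max (-b) (min b x) ≤ b := max_le (by linarith) (min_le_left _ _)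
  generalize max (-b) (min b x) = y at *
  rw [abs_le]
  constructor
  · nlinarith [mul_nonneg (sq_nonneg (b + y)) (by linarith : 0 ≤ 2 * b - y)]
  · nlinarith [mul_nonneg (sq_nonneg (b - y)) (by linarith : 0 ≤ 2 * b + y)]

/-- The derivatives are b² - x² on the left and its positive part on the right, so clamped minus
unclamped is monotone. -/
theorem cubic_sub_le {b : ℝ} (hb : 0 ≤ b) {x y : ℝ} (hxy : x ≤ y) :
    (b ^ 2 * y - y ^ 3 / 3) - (b ^ 2 * x - x ^ 3 / 3) ≤ clampedCubic b y - clampedCubic b x := by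
  have key : Monotone fun x => clampedCubic b x - (b ^ 2 * x - x ^ 3 / 3) := by
    have e1 : ∀ x, b ≤ x → clampedCubic b x = b ^ 2 * b - b ^ 3 / 3 := fun x hx => by
      rw [clampedCubic, min_eq_left hx, max_eq_right (by linarith)]
    have e2 : ∀ x, x ≤ -b → clampedCubic b x = b ^ 2 * (-b) - (-b) ^ 3 / 3 := fun x hx => by
      rw [clampedCubic, min_eq_right (by linarith), max_eq_left hx]
    have e3 : ∀ x, -b ≤ x → x ≤ b → clampedCubic b x = b ^ 2 * x - x ^ 3 / 3 := fun x hx hx' => by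
      rw [clampedCubic, min_eq_right hx', max_eq_right hx]
    have m1 : MonotoneOn (fun x => clampedCubic b x - (b ^ 2 * x - x ^ 3 / 3)) (Set.Iic (-b)) := by
      intro x hx y hy hxy
      simp only [Set.mem_Iic] at hx hy
      simp only [e2 x hx, e2 y hy]
      nlinarith [mul_nonneg (sub_nonneg.2 hxy) (by nlinarith : 0 ≤ x ^ 2 + x * y + y ^ 2 - 3 * b ^ 2)]
    have m2 : MonotoneOn (fun x => clampedCubic b x - (b ^ 2 * x - x ^ 3 / 3)) (Set.Ici b) := by
      intro x hx y hy hxy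
      simp only [Set.mem_Ici] at hx hy
      simp only [e1 x hx, e1 y hy]
      nlinarith [mul_nonneg (sub_nonneg.2 hxy) (by nlinarith : 0 ≤ x ^ 2 + x * y + y ^ 2 - 3 * b ^ 2)]
    have m3 : MonotoneOn (fun x => clampedCubic b x - (b ^ 2 * x - x ^ 3 / 3)) (Set.Icc (-b) b) := by
      intro x hx y hy hxy
      simp only [e3 x hx.1 hx.2, e3 y hy.1 hy.2, sub_self, le_refl]
    have m4 : MonotoneOn (fun x => clampedCubic b x - (b ^ 2 * x - x ^ 3 / 3)) (Set.Iic b) := by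
      have := m1.union_right m3 isGreatest_Iic ⟨⟨le_rfl, by linarith⟩, fun x hx => hx.1⟩
      rwa [Set.Iic_union_Icc_eq_Iic (by linarith)] at this
    exact m4.Iic_union_Ici m2
  have := key hxy
  simp only at this
  linarith

/-! ### Upper and lower bounds for the weighted autocorrelation -/

namespace IsTwistedSign

variable {N : ℕ} {σ : ℕ → ℝ}

/-- For each triple of places p < p + q + 1 < p + r + 1 the product below is nonnegative; it is
positive only if the sign changes and then changes back. Summed over p, its expansion is linear in
the autocorrelations. -/
theorem weightedCorr_le (h : IsTwistedSign N σ) (hN : 0 < N) :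
    weightedCorr N σ ≤ N * (N - 1) * (N - 2) / 3 := by
  obtain ⟨n, rfl⟩ : ∃ n, N = n + 1 := ⟨N - 1, by omega⟩
  have h0 : 0 ≤ ∑ p ∈ range (n + 1), ∑ r ∈ range n, ∑ q ∈ range r,
      (1 - σ p * σ (p + (q + 1))) * (1 + σ p * σ (p + (r + 1))) := by
    refine Finset.sum_nonneg fun p _ => Finset.sum_nonneg fun r _ => Finset.sum_nonneg fun q _ => ?_
    rcases h.sign p with h1 | h1 <;> rcases h.sign (p + (q + 1)) with h2 | h2 <;>
      rcases h.sign (p + (r + 1)) with h3 | h3 <;> rw [h1, h2, h3] <;> norm_num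
  have h1 : ∑ p ∈ range (n + 1), ∑ r ∈ range n, ∑ q ∈ range r,
      (1 - σ p * σ (p + (q + 1))) * (1 + σ p * σ (p + (r + 1))) =
      ∑ r ∈ range n, ∑ q ∈ range r, (((n + 1 : ℕ) : ℝ) - autocorr (n + 1) σ (q + 1)
        + autocorr (n + 1) σ (r + 1) - autocorr (n + 1) σ (r - q)) := by
    rw [Finset.sum_comm]
    refine Finset.sum_congr rfl fun r _ => ?_
    rw [Finset.sum_comm]
    refine Finset.sum_congr rfl fun q hq => ?_
    have hq' := mem_range.1 hq
    rw [← h.sum_shift (q + 1) (r - q), autocorr, autocorr]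
    have hc : ((n + 1 : ℕ) : ℝ) = ∑ p ∈ range (n + 1), (1 : ℝ) := by simp
    rw [hc, ← Finset.sum_sub_distrib, ← Finset.sum_add_distrib, ← Finset.sum_sub_distrib]
    refine Finset.sum_congr rfl fun p _ => ?_
    have : p + (q + 1) + (r - q) = p + (r + 1) := by omega
    rw [this]
    linear_combination (-(σ (p + (q + 1)) * σ (p + (r + 1)))) * h.mul_self p
  rw [h1, sum_triangle] at h0
  have h2 := h.sum_autocorr
  -- The autocorrelations sum to zero, so a constant may be split off to make the weights
  -- antisymmetric under d ↦ N - d.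
  have h3 : ∑ e ∈ range n, (3 * (e : ℝ) + 2 - 2 * n) * autocorr (n + 1) σ (e + 1) =
      -(3 / 2) * weightedCorr (n + 1) σ +
        (1 / 2 - n / 2) * ∑ e ∈ range n, autocorr (n + 1) σ (e + 1) := by
    rw [weightedCorr, Nat.add_sub_cancel, Finset.mul_sum, Finset.mul_sum,
      ← Finset.sum_add_distrib]
    exact Finset.sum_congr rfl fun e _ => by push_cast; ring
  simp only [Nat.add_sub_cancel] at h2
  rw [h3, h2] at h0
  push_cast at h0 ⊢
  linarith

theorem sum_sq_window (h : IsTwistedSign N σ) (n : ℕ) :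
    ∑ p ∈ range N, (∑ j ∈ range n, σ (p + j)) ^ 2 =
      n * N + 2 * ∑ e ∈ range n, ((n : ℝ) - (e + 1)) * autocorr N σ (e + 1) := by
  induction n with
  | zero => simp
  | succ n ih =>
    have h1 : ∑ p ∈ range N, (∑ j ∈ range (n + 1), σ (p + j)) ^ 2 =
        ∑ p ∈ range N, (∑ j ∈ range n, σ (p + j)) ^ 2 +
          2 * (∑ j ∈ range n, ∑ p ∈ range N, σ (p + j) * σ (p + n)) + N := by
      rw [Finset.sum_comm (s := range n)]
      have hc : (N : ℝ) = ∑ p ∈ range N, (1 : ℝ) := by simp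
      rw [hc, Finset.mul_sum, ← Finset.sum_add_distrib, ← Finset.sum_add_distrib]
      refine Finset.sum_congr rfl fun p _ => ?_
      rw [Finset.sum_range_succ, ← Finset.sum_mul]
      linear_combination h.mul_self (p + n)
    have h2 : ∑ j ∈ range n, ∑ p ∈ range N, σ (p + j) * σ (p + n) =
        ∑ j ∈ range n, autocorr N σ (j + 1) := by
      rw [← sum_range_reflect_succ]
      refine Finset.sum_congr rfl fun j hj => ?_
      rw [← h.sum_shift j (n - j)]
      have := mem_range.1 hj
      refine Finset.sum_congr rfl fun p _ => ?_
      rw [show p + j + (n - j) = p + n by omega]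
    have h3 : ∑ e ∈ range n, (((n + 1 : ℕ) : ℝ) - (e + 1)) * autocorr N σ (e + 1) =
        ∑ e ∈ range n, ((n : ℝ) - (e + 1)) * autocorr N σ (e + 1) +
          ∑ e ∈ range n, autocorr N σ (e + 1) := by
      rw [← Finset.sum_add_distrib]
      exact Finset.sum_congr rfl fun e _ => by push_cast; ring
    rw [h1, ih, h2, Finset.sum_range_succ, h3]
    push_cast
    ring

/-- The antiperiodic primitive of `σ`. -/
noncomputable def primitive (N : ℕ) (σ : ℕ → ℝ) (p : ℕ) : ℝ :=
  -(1 / 2) * ∑ j ∈ range N, σ (p + j)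

/-- The sliding window loses σ(p) and gains σ(p + N) = -σ(p); this change by -2σ(p) explains the
factor -1/2. -/
theorem primitive_succ (h : IsTwistedSign N σ) (p : ℕ) :
    primitive N σ (p + 1) = primitive N σ p + σ p := by
  have h1 := Finset.sum_range_succ (fun j => σ (p + j)) N
  have h2 := Finset.sum_range_succ' (fun j => σ (p + j)) N
  have h3 : ∑ j ∈ range N, σ (p + 1 + j) = ∑ j ∈ range N, σ (p + (j + 1)) :=
    Finset.sum_congr rfl fun j _ => by congr 1; ring
  rw [primitive, primitive, h3]
  have := h.anti p
  simp only [add_zero] at h2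
  linarith

theorem primitive_anti (h : IsTwistedSign N σ) (p : ℕ) :
    primitive N σ (p + N) = -primitive N σ p := by
  have : ∑ j ∈ range N, σ (p + N + j) = -∑ j ∈ range N, σ (p + j) := by
    rw [← Finset.sum_neg_distrib]
    exact Finset.sum_congr rfl fun j _ => by rw [add_right_comm, h.anti]
  rw [primitive, primitive, this]
  ring

/-- With U the piecewise linear interpolation of the primitive u, each summand is ∫₀¹ (u + σt)² dt,
so the left side is the integral of U² over one antiperiod. -/
theorem sum_primitive (h : IsTwistedSign N σ) (hN : 0 < N) :
    ∑ p ∈ range N, (primitive N σ p ^ 2 + primitive N σ p * σ p + 1 / 3) =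
      (N : ℝ) ^ 2 / 4 + weightedCorr N σ / 4 - N / 6 := by
  obtain ⟨n, rfl⟩ : ∃ n, N = n + 1 := ⟨N - 1, by omega⟩
  have h1 := h.sum_sq_window (n + 1)
  have h2 := h.sum_autocorr
  simp only [Nat.add_sub_cancel] at h2
  have h3 : ∑ p ∈ range (n + 1), primitive (n + 1) σ p * σ p = -(1 / 2) * ((n + 1 : ℕ) : ℝ) := by
    have : ∀ p, primitive (n + 1) σ p * σ p =
        -(1 / 2) * ∑ j ∈ range (n + 1), σ p * σ (p + j) := fun p => by
      rw [primitive, ← Finset.mul_sum]; ring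
    simp only [this]
    rw [← Finset.mul_sum, Finset.sum_comm]
    change -(1 / 2) * ∑ d ∈ range (n + 1), autocorr (n + 1) σ d = _
    rw [Finset.sum_range_succ', h2, h.autocorr_zero, zero_add]
  have h4 : ∑ p ∈ range (n + 1), primitive (n + 1) σ p ^ 2 =
      1 / 4 * ∑ p ∈ range (n + 1), (∑ j ∈ range (n + 1), σ (p + j)) ^ 2 := by
    rw [Finset.mul_sum]
    exact Finset.sum_congr rfl fun p _ => by rw [primitive]; ring
  have h5 : ∑ e ∈ range (n + 1), (((n + 1 : ℕ) : ℝ) - (e + 1)) * autocorr (n + 1) σ (e + 1) =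
      1 / 2 * weightedCorr (n + 1) σ +
        ((n + 1 : ℕ) : ℝ) / 2 * ∑ e ∈ range n, autocorr (n + 1) σ (e + 1) := by
    rw [Finset.sum_range_succ, weightedCorr, Finset.mul_sum, Finset.mul_sum,
      Nat.add_sub_cancel, ← Finset.sum_add_distrib]
    have : (((n + 1 : ℕ) : ℝ) - (n + 1)) = 0 := by push_cast; ring
    rw [this, zero_mul, add_zero]
    exact Finset.sum_congr rfl fun e _ => by ring
  rw [Finset.sum_add_distrib, Finset.sum_add_distrib, h3, h4, h1, h5, h2]
  simp only [Finset.sum_const, card_range, nsmul_eq_mul]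
  ring

/-- The integral of b² - U² is at most that of its positive part, whose primitive is `clampedCubic`.
Summation by parts moves the difference onto σ, and |σ(p) - σ(p + 1)| = 1 - σ(p)σ(p + 1) counts sign
changes. -/
theorem le_sum_primitive (h : IsTwistedSign N σ) {b : ℝ} (hb : 0 ≤ b) :
    N * b ^ 2 - 2 * b ^ 3 / 3 * (N - autocorr N σ 1) ≤
      ∑ p ∈ range N, (primitive N σ p ^ 2 + primitive N σ p * σ p + 1 / 3) := by
  set u := primitive N σ
  set Φ := clampedCubic b
  have h1 : ∀ p, b ^ 2 - (u p ^ 2 + u p * σ p + 1 / 3) ≤ σ p * (Φ (u (p + 1)) - Φ (u p)) := by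
    intro p
    have hp : u (p + 1) = u p + σ p := h.primitive_succ p
    rw [hp]
    rcases h.sign p with hp | hp <;> rw [hp]
    · have := cubic_sub_le hb (x := u p) (y := u p + 1) (by linarith)
      linear_combination this
    · have := cubic_sub_le hb (x := u p + -1) (y := u p) (by linarith)
      linear_combination this
  -- Φ is odd and σ, u are antiperiodic, so σΦ(u) is periodic.
  have h2 : ∑ p ∈ range N, σ (p + 1) * Φ (u (p + 1)) = ∑ p ∈ range N, σ p * Φ (u p) := by
    refine sum_range_add_of_periodic (g := fun p => σ p * Φ (u p)) (fun n => ?_) 1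
    simp only [u, Φ]
    rw [h.anti, h.primitive_anti, clampedCubic_neg hb, neg_mul_neg]
  have h3 : ∑ p ∈ range N, σ p * (Φ (u (p + 1)) - Φ (u p)) =
      ∑ p ∈ range N, (σ p - σ (p + 1)) * Φ (u (p + 1)) := by
    simp only [mul_sub, sub_mul, Finset.sum_sub_distrib, h2]
  have h4 : ∀ p, (σ p - σ (p + 1)) * Φ (u (p + 1)) ≤ 2 * b ^ 3 / 3 * (1 - σ p * σ (p + 1)) := by
    intro p
    have := abs_le.1 (abs_clampedCubic_le hb (u (p + 1)))
    rcases h.sign p with hp | hp <;> rcases h.sign (p + 1) with hq | hq <;> rw [hp, hq] <;>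
      simp only [Φ] <;> linarith
  have h5 := Finset.sum_le_sum fun p (_ : p ∈ range N) => h1 p
  have h6 := Finset.sum_le_sum fun p (_ : p ∈ range N) => h4 p
  rw [h3] at h5
  rw [← Finset.mul_sum, Finset.sum_sub_distrib] at h6
  rw [Finset.sum_sub_distrib] at h5
  simp only [Finset.sum_const, card_range, nsmul_eq_mul, mul_one] at h5 h6
  rw [autocorr]
  linarith

theorem le_weightedCorr (h : IsTwistedSign N σ) (hN : 0 < N) {m : ℝ} (hm : 0 < m)
    (hR : autocorr N σ 1 = N - 2 * m) :
    (N : ℝ) ^ 3 / (3 * m ^ 2) - N ^ 2 + 2 * N / 3 ≤ weightedCorr N σ := by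
  -- This b maximises N b² - 4 m b³ / 3; it is half the mean gap between tokens.
  have h1 := h.le_sum_primitive (b := N / (2 * m)) (by positivity)
  rw [h.sum_primitive hN, hR] at h1
  have h2 : (N : ℝ) * (N / (2 * m)) ^ 2 - 2 * (N / (2 * m)) ^ 3 / 3 * (N - (N - 2 * m)) =
      N ^ 3 / (3 * m ^ 2) / 4 := by
    field_simp
    ring
  rw [h2] at h1
  linarith

theorem sum_secondDiff_autocorr (h : IsTwistedSign N σ) (hN : 0 < N) :
    ∑ e ∈ range (N - 1), ((N : ℝ) - 2 * ((e : ℝ) + 1)) *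
      (autocorr N σ e + autocorr N σ (e + 2) - 2 * autocorr N σ (e + 1)) =
      2 * N * (N - 2 - autocorr N σ 1) := by
  obtain ⟨n, rfl⟩ : ∃ n, N = n + 1 := ⟨N - 1, by omega⟩
  have h1 := sum_secondDiff (fun e => ((n + 1 : ℕ) : ℝ) - 2 * (e : ℝ)) (autocorr (n + 1) σ)
    (fun e => by push_cast; ring) n
  rw [h.autocorr_reflect (d := 0) (e := n + 1) (by ring),
    h.autocorr_reflect (d := 1) (e := n) (by ring), h.autocorr_zero] at h1
  simp only [Nat.add_sub_cancel]
  push_cast at h1 ⊢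
  rw [h1]
  ring

end IsTwistedSign

/-! ### Spins of a state and their evolution in one step -/

variable {N : ℕ}

/-- The sign `-1` on a set and `1` off it. -/
def setSign (A : State N) (z : ZMod N) : ℝ :=
  if z ∈ A then -1 else 1

theorem setSign_mul_self (A : State N) (z : ZMod N) : setSign A z * setSign A z = 1 := by
  unfold setSign; split_ifs <;> norm_num

theorem setSign_symmDiff (A B : State N) (z : ZMod N) :
    setSign (symmDiff A B) z = setSign A z * setSign B z := by
  by_cases h1 : z ∈ A <;> by_cases h2 : z ∈ B <;> simp [setSign, Finset.mem_symmDiff, h1, h2]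

theorem setSign_sdiff {A M : State N} (h : M ⊆ A) (z : ZMod N) :
    setSign (A \ M) z = setSign A z * setSign M z := by
  by_cases h1 : z ∈ A <;> by_cases h2 : z ∈ M <;> simp [setSign, h1, h2]
  exact absurd (h h2) h1

theorem setSign_image_add_one (M : State N) (z : ZMod N) :
    setSign (M.image (fun p => p + 1)) z = setSign M (z - 1) := by
  have : z ∈ M.image (fun p => p + 1) ↔ z - 1 ∈ M := by
    simp only [Finset.mem_image]
    exact ⟨by rintro ⟨a, ha, rfl⟩; simpa, fun h => ⟨_, h, by simp⟩⟩
  simp only [setSign, this]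

theorem setSign_move {A M : State N} (h : M ⊆ A) (z : ZMod N) :
    setSign (move A M) z = setSign A z * setSign M z * setSign M (z - 1) := by
  rw [move, setSign_symmDiff, setSign_sdiff h, setSign_image_add_one]

/-- The sign that changes at each token met on the way from `0` to `n`. -/
def spin (A : State N) (n : ℕ) : ℝ :=
  ∏ j ∈ range n, setSign A (j : ZMod N)

theorem spin_succ (A : State N) (n : ℕ) : spin A (n + 1) = spin A n * setSign A n :=
  Finset.prod_range_succ _ _

theorem spin_mul_self (A : State N) (n : ℕ) : spin A n * spin A n = 1 := by
  rw [spin, ← Finset.prod_mul_distrib]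
  exact Finset.prod_eq_one fun _ _ => setSign_mul_self _ _

theorem prod_range_zmod [NeZero N] (f : ZMod N → ℝ) :
    ∏ p ∈ range N, f (p : ZMod N) = ∏ z, f z := by
  refine Finset.prod_bij' (fun p _ => (p : ZMod N)) (fun z _ => z.val) ?_ ?_ ?_ ?_ ?_
  · simp
  · intro z _; simpa using ZMod.val_lt z
  · intro p hp; exact ZMod.val_cast_of_lt (by simpa using hp)
  · intro z _; simp
  · simp

theorem sum_range_zmod [NeZero N] (f : ZMod N → ℝ) :
    ∑ p ∈ range N, f (p : ZMod N) = ∑ z, f z := by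
  refine Finset.sum_bij' (fun p _ => (p : ZMod N)) (fun z _ => z.val) ?_ ?_ ?_ ?_ ?_
  · simp
  · intro z _; simpa using ZMod.val_lt z
  · intro p hp; exact ZMod.val_cast_of_lt (by simpa using hp)
  · intro z _; simp
  · simp

theorem prod_setSign [NeZero N] (A : State N) : ∏ z, setSign A z = (-1) ^ A.card := by
  simp [setSign]

theorem sum_setSign [NeZero N] (A : State N) : ∑ z, setSign A z = N - 2 * A.card := by
  have : ∀ z, setSign A z = 1 - 2 * (if z ∈ A then 1 else 0) := fun z => by
    unfold setSign; split_ifs <;> norm_num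
  simp [this, ZMod.card, mul_comm]

theorem isTwistedSign_spin [NeZero N] {A : State N} (hA : Odd A.card) :
    IsTwistedSign N (spin A) where
  sign n := mul_self_eq_one_iff.1 (spin_mul_self A n)
  anti n := by
    induction n with
    | zero => rw [zero_add, spin, prod_range_zmod, prod_setSign, hA.neg_one_pow]; simp [spin]
    | succ n ih => rw [add_right_comm, spin_succ, ih, spin_succ]; simp

theorem autocorr_spin_one [NeZero N] (A : State N) :
    autocorr N (spin A) 1 = N - 2 * A.card := by
  rw [← sum_setSign, ← sum_range_zmod, autocorr]
  refine Finset.sum_congr rfl fun p _ => ?_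
  rw [spin_succ, ← mul_assoc, spin_mul_self, one_mul]

/-- Parity is the product of all signs, in which the two factors coming from `M` cancel. -/
theorem odd_card_move [NeZero N] {A M : State N} (h : M ⊆ A) (hA : Odd A.card) :
    Odd (move A M).card := by
  have h1 := prod_setSign (move A M)
  simp only [setSign_move h, Finset.prod_mul_distrib] at h1
  rw [Fintype.prod_equiv (Equiv.subRight (1 : ZMod N)) (fun z => setSign M (z - 1)) (setSign M)
    (fun z => by simp), mul_assoc, ← Finset.prod_mul_distrib,
    Finset.prod_eq_one (fun z _ => setSign_mul_self M z), mul_one, prod_setSign,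
    hA.neg_one_pow] at h1
  by_contra h2
  rw [(Nat.not_odd_iff_even.1 h2).neg_one_pow] at h1
  norm_num at h1

/-- Multiplying `setSign_move` over p + 1, …, p + d telescopes the signs of `M` to the two ends. -/
theorem spin_mul_spin_move {A M : State N} (h : M ⊆ A) (p d : ℕ) :
    spin (move A M) (p + 1) * spin (move A M) (p + 1 + d) =
      spin A (p + 1) * spin A (p + 1 + d) * (setSign M p * setSign M ((p + d : ℕ) : ZMod N)) := by
  induction d with
  | zero => simp [spin_mul_self, setSign_mul_self]
  | succ d ih =>
    rw [← add_assoc, spin_succ _ (p + 1 + d), ← mul_assoc, ih, spin_succ _ (p + 1 + d),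
      setSign_move h]
    have : ((p + 1 + d : ℕ) : ZMod N) - 1 = ((p + d : ℕ) : ZMod N) := by push_cast; ring
    rw [this, ← add_assoc, show p + d + 1 = p + 1 + d by ring]
    linear_combination (spin A (p + 1) * spin A (p + 1 + d) * setSign M p *
      setSign A ((p + 1 + d : ℕ) : ZMod N) * setSign M ((p + 1 + d : ℕ) : ZMod N)) *
        setSign_mul_self M ((p + d : ℕ) : ZMod N)

/-- Toggling the decision of the token at `x` flips the sign at `x` only. -/
theorem sum_powerset_setSign_of_mem {A : State N} {x y : ZMod N} (hx : x ∈ A) (hxy : x ≠ y) :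
    ∑ M ∈ A.powerset, setSign M x * setSign M y = 0 := by
  refine Finset.sum_involution (fun M _ => symmDiff M {x}) ?_ ?_ ?_ ?_
  · intro M _
    have h1 : setSign ({x} : State N) x = -1 := by simp [setSign]
    have h2 : setSign ({x} : State N) y = 1 := by simp [setSign, hxy.symm]
    rw [setSign_symmDiff, setSign_symmDiff, h1, h2]
    ring
  · intro M _ _ h
    rw [symmDiff_eq_left] at h
    simp at h
  · intro M hM
    rw [Finset.mem_powerset] at hM ⊢
    intro z hz
    rw [Finset.mem_symmDiff, Finset.mem_singleton] at hz
    rcases hz with hz | hz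
    · exact hM hz.1
    · exact hz.1 ▸ hx
  · intro M _
    exact symmDiff_symmDiff_cancel_right _ _

theorem sum_powerset_setSign (A : State N) {x y : ZMod N} (hxy : x ≠ y) :
    ∑ M ∈ A.powerset, setSign M x * setSign M y =
      2 ^ A.card * ((1 + setSign A x) / 2 * ((1 + setSign A y) / 2)) := by
  by_cases hx : x ∈ A
  · rw [sum_powerset_setSign_of_mem hx hxy]; simp [setSign, hx]
  by_cases hy : y ∈ A
  · simp_rw [mul_comm (setSign _ x)]
    rw [sum_powerset_setSign_of_mem hy hxy.symm]; simp [setSign, hy]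
  · have : ∀ M ∈ A.powerset, setSign M x * setSign M y = 1 := fun M hM => by
      rw [Finset.mem_powerset] at hM
      have hx' : x ∉ M := fun h => hx (hM h)
      have hy' : y ∉ M := fun h => hy (hM h)
      simp [setSign, hx', hy']
    rw [Finset.sum_congr rfl this]
    simp [setSign, hx, hy]

/-- The mean factor (1 + sign)/2 turns σ(p + 1) into (σ(p) + σ(p + 1))/2. Expanding the product of
two such averages at distance e + 1 gives the distances e, e + 1 (twice) and e + 2. -/
theorem sum_powerset_autocorr [NeZero N] {A : State N} (hA : Odd A.card) {e : ℕ}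
    (he : e + 1 < N) :
    ∑ M ∈ A.powerset, autocorr N (spin (move A M)) (e + 1) =
      2 ^ A.card * (autocorr N (spin A) (e + 1) + (autocorr N (spin A) e +
        autocorr N (spin A) (e + 2) - 2 * autocorr N (spin A) (e + 1)) / 4) := by
  have hs := isTwistedSign_spin hA
  have h1 : ∑ M ∈ A.powerset, autocorr N (spin (move A M)) (e + 1) =
      ∑ M ∈ A.powerset, ∑ p ∈ range N, spin A (p + 1) * spin A (p + 1 + (e + 1)) *
        (setSign M p * setSign M ((p + (e + 1) : ℕ) : ZMod N)) := by
    refine Finset.sum_congr rfl fun M hM => ?_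
    rw [Finset.mem_powerset] at hM
    rw [← (isTwistedSign_spin (odd_card_move hM hA)).sum_shift 1]
    exact Finset.sum_congr rfl fun p _ => spin_mul_spin_move hM _ _
  have h2 : ∀ p : ℕ, ∑ M ∈ A.powerset, spin A (p + 1) * spin A (p + 1 + (e + 1)) *
        (setSign M p * setSign M ((p + (e + 1) : ℕ) : ZMod N)) =
      2 ^ A.card / 4 * (spin A (p + 1) * spin A (p + 1 + (e + 1)) +
        spin A (p + 1) * spin A (p + 1 + e) + spin A p * spin A (p + (e + 2)) +
        spin A p * spin A (p + (e + 1))) := by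
    intro p
    -- Independence needs distinct processors, hence 0 < e + 1 < N.
    have hne : (p : ZMod N) ≠ ((p + (e + 1) : ℕ) : ZMod N) := by
      intro h
      have h' : ((e + 1 : ℕ) : ZMod N) = 0 := by
        rw [Nat.cast_add p] at h
        exact left_eq_add.1 h
      rw [ZMod.natCast_eq_zero_iff] at h'
      exact absurd (Nat.le_of_dvd (by omega) h') (by omega)
    rw [← Finset.mul_sum, sum_powerset_setSign A hne,
      show p + 1 + (e + 1) = p + (e + 1) + 1 by ring, show p + (e + 2) = p + (e + 1) + 1 by ring,
      show p + 1 + e = p + (e + 1) by ring, spin_succ A p, spin_succ A (p + (e + 1))]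
    have e1 := setSign_mul_self A (p : ZMod N)
    have e2 := setSign_mul_self A ((p + (e + 1) : ℕ) : ZMod N)
    generalize setSign A (p : ZMod N) = a at *
    generalize setSign A ((p + (e + 1) : ℕ) : ZMod N) = c at *
    generalize spin A p = s at *
    generalize spin A (p + (e + 1)) = r at *
    linear_combination (2 ^ A.card / 4 * s * r * (c + 1)) * e1 +
      (2 ^ A.card / 4 * s * r * (a + a * a)) * e2
  rw [h1, Finset.sum_comm, Finset.sum_congr rfl (fun p _ => h2 p), ← Finset.mul_sum,
    Finset.sum_add_distrib, Finset.sum_add_distrib, Finset.sum_add_distrib, hs.sum_shift,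
    hs.sum_shift]
  simp only [autocorr]
  ring

/-! ### The potential and its mean decrease -/

/-- The expected total cost of a run from `A`. -/
noncomputable def potential (A : State N) : ℝ :=
  ((N : ℝ) - 1) * (N - 2) / 6 - weightedCorr N (spin A) / (2 * N)

theorem potential_nonneg [NeZero N] {A : State N} (hA : Odd A.card) : 0 ≤ potential A := by
  have hN : 0 < N := NeZero.pos N
  have h := (isTwistedSign_spin hA).weightedCorr_le hN
  have hN' : (0 : ℝ) < N := by exact_mod_cast hN
  rw [potential, sub_nonneg, div_le_iff₀ (by positivity)]
  linarith

theorem potential_le [NeZero N] {A : State N} (hA : Odd A.card) :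
    potential A ≤ (1 - 1 / (A.card : ℝ) ^ 2) * (N : ℝ) ^ 2 / 6 := by
  have hN : 0 < N := NeZero.pos N
  have hN' : (0 : ℝ) < N := by exact_mod_cast hN
  have hm : (0 : ℝ) < A.card := by exact_mod_cast hA.pos
  have h := (isTwistedSign_spin hA).le_weightedCorr hN hm (autocorr_spin_one A)
  have h1 := div_le_div_of_nonneg_right h (by positivity : (0 : ℝ) ≤ 2 * N)
  have h2 : ((N : ℝ) ^ 3 / (3 * (A.card : ℝ) ^ 2) - N ^ 2 + 2 * N / 3) / (2 * N) =
      (N - 1) * (N - 2) / 6 - (1 - 1 / (A.card : ℝ) ^ 2) * (N : ℝ) ^ 2 / 6 := by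
    field_simp
    ring
  rw [potential]
  linarith

theorem sum_powerset_potential [NeZero N] {A : State N} (hA : Odd A.card) :
    ∑ M ∈ A.powerset, potential (move A M) =
      2 ^ A.card * (potential A - ((A.card : ℝ) - 1) / 2) := by
  have hN : 0 < N := NeZero.pos N
  have hN' : (0 : ℝ) < N := by exact_mod_cast hN
  have hs := isTwistedSign_spin hA
  have h1 : ∑ M ∈ A.powerset, weightedCorr N (spin (move A M)) =
      2 ^ A.card * (weightedCorr N (spin A) + N * (A.card - 1)) := by
    have h2 := hs.sum_secondDiff_autocorr hN
    rw [autocorr_spin_one] at h2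
    have h3 : (N : ℝ) * (A.card - 1) = 1 / 4 * (2 * N * (N - 2 - (N - 2 * A.card))) := by ring
    rw [h3, ← h2]
    simp only [weightedCorr]
    rw [Finset.sum_comm, Finset.mul_sum, ← Finset.sum_add_distrib, Finset.mul_sum]
    refine Finset.sum_congr rfl fun e he => ?_
    rw [← Finset.mul_sum, sum_powerset_autocorr hA (by have := mem_range.1 he; omega)]
    ring
  simp only [potential]
  rw [Finset.sum_sub_distrib, ← Finset.sum_div _ (fun M => weightedCorr N (spin (move A M))), h1]
  simp only [Finset.sum_const, card_powerset, nsmul_eq_mul]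
  field_simp
  push_cast
  ring

theorem step_apply [NeZero N] (A y : State N) :
    step A y = ∑ M ∈ A.powerset, if y = move A M then ((2 : ℝ≥0∞) ^ A.card)⁻¹ else 0 := by
  have hu : ∀ M, PMF.uniformOfFinset A.powerset ⟨∅, Finset.empty_mem_powerset A⟩ M =
      if M ∈ A.powerset then ((2 : ℝ≥0∞) ^ A.card)⁻¹ else 0 := fun M => by
    refine (PMF.uniformOfFinset_apply ⟨∅, Finset.empty_mem_powerset A⟩ M).trans ?_
    rw [card_powerset]
    push_cast
    rfl
  refine (PMF.map_apply _ _ _).trans ?_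
  rw [tsum_fintype, ← Finset.sum_subset (Finset.subset_univ A.powerset)]
  · refine Finset.sum_congr rfl fun M hM => ?_
    split_ifs
    · exact (hu M).trans (if_pos hM)
    · rfl
  · intro M _ hM
    split_ifs
    · exact (hu M).trans (if_neg hM)
    · rfl

theorem sum_step_mul [NeZero N] (A : State N) (V : State N → ℝ≥0∞) :
    ∑ y, step A y * V y = ((2 : ℝ≥0∞) ^ A.card)⁻¹ * ∑ M ∈ A.powerset, V (move A M) := by
  simp only [step_apply, Finset.sum_mul]
  rw [Finset.sum_comm, Finset.mul_sum]
  refine Finset.sum_congr rfl fun M _ => ?_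
  simp [ite_mul]

theorem step_eq_zero_of_not_odd [NeZero N] {A y : State N} (hA : Odd A.card)
    (hy : ¬ Odd y.card) : step A y = 0 := by
  rw [step_apply]
  refine Finset.sum_eq_zero fun M hM => if_neg ?_
  rintro rfl
  exact hy (odd_card_move (Finset.mem_powerset.1 hM) hA)

theorem stepCost_eq_ofReal (A : State N) :
    stepCost A = ENNReal.ofReal (((A.card : ℝ) - 1) / 2) := by
  rw [stepCost, ENNReal.ofReal_div_of_pos (by norm_num), ENNReal.ofReal_sub _ (by norm_num)]
  simp

theorem sum_step_mul_potential [NeZero N] {A : State N} (hA : Odd A.card) :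
    ∑ y, step A y * ENNReal.ofReal (potential y) + stepCost A = ENNReal.ofReal (potential A) := by
  have h1 := sum_powerset_potential hA
  have h2 : ∀ M ∈ A.powerset, 0 ≤ potential (move A M) := fun M hM =>
    potential_nonneg (odd_card_move (Finset.mem_powerset.1 hM) hA)
  -- This is the mean potential after the step, an average of nonnegative values.
  have h3 : 0 ≤ potential A - ((A.card : ℝ) - 1) / 2 := by
    have h4 := Finset.sum_nonneg h2
    rw [h1] at h4
    exact nonneg_of_mul_nonneg_right h4 (by positivity)
  have h5 : (0 : ℝ) ≤ ((A.card : ℝ) - 1) / 2 := by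
    have : (1 : ℝ) ≤ A.card := by exact_mod_cast hA.pos
    linarith
  rw [sum_step_mul, ← ENNReal.ofReal_sum_of_nonneg h2, h1, ENNReal.ofReal_mul (by positivity),
    ENNReal.ofReal_pow (by norm_num), ENNReal.ofReal_ofNat, ← mul_assoc,
    ENNReal.inv_mul_cancel (by simp) (by simp), one_mul, stepCost_eq_ofReal,
    ← ENNReal.ofReal_add h3 h5, sub_add_cancel]

/-! ### Runs of the chain and the expected total cost -/

section Run

variable {Ω : Type*} [MeasurableSpace Ω] {μ : Measure Ω}

theorem measure_eq_sum_inter_fiber {ι : Type*} [Fintype ι] (F : Ω → ι)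
    (hF : ∀ i, MeasurableSet (F ⁻¹' {i})) (S : Set Ω) : μ S = ∑ i, μ (F ⁻¹' {i} ∩ S) := by
  have h := sum_measure_preimage_singleton (μ := μ.restrict S) Finset.univ fun i _ => hF i
  simp only [Measure.restrict_apply (hF _)] at h
  rw [h]
  simp

theorem lintegral_comp_fintype {ι : Type*} [Fintype ι] {F : Ω → ι}
    (hF : ∀ i, MeasurableSet {ω | F ω = i}) (g : ι → ℝ≥0∞) :
    ∫⁻ ω, g (F ω) ∂μ = ∑ i, μ {ω | F ω = i} * g i := by
  let _ : MeasurableSpace ι := ⊤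
  have : MeasurableSingletonClass ι := ⟨fun _ => trivial⟩
  have hm : Measurable F := measurable_to_countable' hF
  rw [← lintegral_map (measurable_from_top (f := g)) hm, lintegral_fintype]
  refine Finset.sum_congr rfl fun i _ => ?_
  rw [Measure.map_apply hm trivial, mul_comm]
  rfl

theorem measurable_comp_fintype {ι : Type*} [Fintype ι] {F : Ω → ι}
    (hF : ∀ i, MeasurableSet {ω | F ω = i}) (g : ι → ℝ≥0∞) : Measurable fun ω => g (F ω) := by
  let _ : MeasurableSpace ι := ⊤
  exact (measurable_from_top (f := g)).comp (measurable_to_countable' hF)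

namespace IsRun

variable {A₀ : State N} {A : ℕ → Ω → State N}

/-- `law` speaks of whole paths; summing over the finitely many histories before time `t` gives the
two-time marginal. -/
theorem measure_inter_succ [NeZero N] (hA : IsRun μ A₀ A) (t : ℕ) (x y : State N) :
    μ {ω | A t ω = x ∧ A (t + 1) ω = y} = μ {ω | A t ω = x} * step x y := by
  let F : Ω → (Fin t → State N) := fun ω i => A i ω
  have hF : ∀ h, MeasurableSet (F ⁻¹' {h}) := fun h => by
    have : F ⁻¹' {h} = ⋂ i : Fin t, {ω | A i ω = h i} := by
      ext ω
      simp [F, funext_iff]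
    rw [this]
    exact MeasurableSet.iInter fun i => hA.measurable _ _
  rw [measure_eq_sum_inter_fiber F hF {ω | A t ω = x ∧ A (t + 1) ω = y},
    measure_eq_sum_inter_fiber F hF {ω | A t ω = x}, Finset.sum_mul]
  refine Finset.sum_congr rfl fun h _ => ?_
  let z : ℕ → State N := fun i => if hi : i < t then h ⟨i, hi⟩ else if i = t then x else y
  have hz : ∀ i : Fin t, z i = h i := fun i => by simp [z]
  have hzt : z t = x := by simp [z]
  have hzt' : z (t + 1) = y := by simp [z]
  have e1 : F ⁻¹' {h} ∩ {ω | A t ω = x} = {ω | ∀ i ≤ t, A i ω = z i} := by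
    ext ω
    simp only [Set.mem_inter_iff, Set.mem_preimage, Set.mem_singleton_iff, Set.mem_ofPred_eq]
    constructor
    · rintro ⟨h1, h2⟩ i hi
      rcases hi.lt_or_eq with hi | rfl
      · rw [hz ⟨i, hi⟩, ← h1]
      · rw [h2, hzt]
    · intro h1
      exact ⟨funext fun i => by rw [← hz, ← h1 i i.2.le], by rw [h1 t le_rfl, hzt]⟩
  have e2 : F ⁻¹' {h} ∩ {ω | A t ω = x ∧ A (t + 1) ω = y} =
      {ω | ∀ i ≤ t + 1, A i ω = z i} := by
    have : {ω | A t ω = x ∧ A (t + 1) ω = y} = {ω | A t ω = x} ∩ {ω | A (t + 1) ω = y} := rfl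
    rw [this, ← Set.inter_assoc, e1]
    ext ω
    simp only [Set.mem_inter_iff, Set.mem_ofPred_eq, Nat.le_succ_iff, or_imp, forall_and,
      forall_eq, hzt']
  rw [e1, e2, hA.law, hzt, hzt']

theorem measure_succ [NeZero N] (hA : IsRun μ A₀ A) (t : ℕ) (y : State N) :
    μ {ω | A (t + 1) ω = y} = ∑ x, μ {ω | A t ω = x} * step x y := by
  rw [measure_eq_sum_inter_fiber (A t) (fun x => hA.measurable t x)]
  exact Finset.sum_congr rfl fun x _ => hA.measure_inter_succ t x y

theorem measure_zero_of_ne (hA : IsRun μ A₀ A) {x : State N} (hx : x ≠ A₀) :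
    μ {ω | A 0 ω = x} = 0 := by
  refine measure_mono_null (fun ω hω => ?_) (ae_iff.1 hA.start)
  simp only [Set.mem_ofPred_eq] at hω ⊢
  rwa [hω]

theorem measure_eq_zero_of_not_odd [NeZero N] (hA : IsRun μ A₀ A) (h₀ : Odd A₀.card) (t : ℕ) :
    ∀ x : State N, ¬ Odd x.card → μ {ω | A t ω = x} = 0 := by
  induction t with
  | zero => exact fun x hx => hA.measure_zero_of_ne fun h => hx (h ▸ h₀)
  | succ t ih =>
    intro y hy
    rw [hA.measure_succ]
    refine Finset.sum_eq_zero fun x _ => ?_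
    by_cases hx : Odd x.card
    · rw [step_eq_zero_of_not_odd hx hy, mul_zero]
    · rw [ih x hx, zero_mul]

theorem ae_odd [NeZero N] (hA : IsRun μ A₀ A) (h₀ : Odd A₀.card) :
    ∀ᵐ ω ∂μ, ∀ t, Odd (A t ω).card := by
  rw [ae_all_iff]
  intro t
  have h1 : ∀ᵐ ω ∂μ, ∀ x : State N, ¬ Odd x.card → A t ω ≠ x := by
    refine ae_all_iff.2 fun x => ?_
    by_cases hx : Odd x.card
    · exact ae_of_all _ fun ω h => absurd hx h
    · have := hA.measure_eq_zero_of_not_odd h₀ t x hx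
      rw [ae_iff]
      refine measure_mono_null (fun ω hω => ?_) this
      simp only [Set.mem_ofPred_eq, not_forall, not_not] at hω
      exact hω.2
  filter_upwards [h1] with ω hω
  by_contra h
  exact hω _ h rfl

theorem lintegral_potential_succ [NeZero N] (hA : IsRun μ A₀ A) (h₀ : Odd A₀.card) (t : ℕ) :
    ∫⁻ ω, ENNReal.ofReal (potential (A (t + 1) ω)) ∂μ + ∫⁻ ω, stepCost (A t ω) ∂μ =
      ∫⁻ ω, ENNReal.ofReal (potential (A t ω)) ∂μ := by
  rw [lintegral_comp_fintype (hA.measurable _) fun x => ENNReal.ofReal (potential x),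
    lintegral_comp_fintype (hA.measurable _) stepCost,
    lintegral_comp_fintype (hA.measurable _) fun x => ENNReal.ofReal (potential x)]
  simp only [hA.measure_succ, Finset.sum_mul]
  rw [Finset.sum_comm, ← Finset.sum_add_distrib]
  refine Finset.sum_congr rfl fun x _ => ?_
  by_cases hx : Odd x.card
  · rw [← sum_step_mul_potential hx, mul_add, Finset.mul_sum]
    simp only [mul_assoc]
  · simp [hA.measure_eq_zero_of_not_odd h₀ t x hx]

theorem lintegral_totalCost_le [NeZero N] [IsProbabilityMeasure μ] (hA : IsRun μ A₀ A)
    (h₀ : Odd A₀.card) :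
    ∫⁻ ω, totalCost (fun t => A t ω) ∂μ ≤ ENNReal.ofReal (potential A₀) := by
  -- Expected cost so far plus expected remaining potential is conserved.
  have h1 : ∀ n, ∑ t ∈ range n, ∫⁻ ω, stepCost (A t ω) ∂μ +
      ∫⁻ ω, ENNReal.ofReal (potential (A n ω)) ∂μ = ENNReal.ofReal (potential A₀) := by
    intro n
    induction n with
    | zero =>
      have : (fun ω => ENNReal.ofReal (potential (A 0 ω))) =ᵐ[μ]
          fun _ => ENNReal.ofReal (potential A₀) := by
        filter_upwards [hA.start] with ω hω
        rw [hω]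
      rw [lintegral_congr_ae this]
      simp
    | succ n ih =>
      rw [Finset.sum_range_succ, add_assoc, add_comm (∫⁻ ω, stepCost (A n ω) ∂μ),
        hA.lintegral_potential_succ h₀, ih]
  simp only [totalCost]
  rw [lintegral_tsum fun t => (measurable_comp_fintype (hA.measurable t) stepCost).aemeasurable]
  exact ENNReal.tsum_le_of_sum_range_le fun n => (h1 n).le.trans' le_self_add

end IsRun

end Run

/-! ### Comparison of stabilisation time and total cost -/

theorem one_le_stepCost {A : State N} (hA : Odd A.card) (h : A.card ≠ 1) : 1 ≤ stepCost A := by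
  rw [stepCost_eq_ofReal, ENNReal.one_le_ofReal]
  have h3 : 3 ≤ A.card := by
    obtain ⟨k, hk⟩ := hA
    omega
  have : (3 : ℝ) ≤ A.card := by exact_mod_cast h3
  linarith

theorem natCast_le_totalCost {A : ℕ → State N} (hA : ∀ t, Odd (A t).card) {n : ℕ}
    (hn : ∀ t < n, (A t).card ≠ 1) : (n : ℝ≥0∞) ≤ totalCost A :=
  calc (n : ℝ≥0∞) = ∑ t ∈ range n, 1 := by simp
    _ ≤ ∑ t ∈ range n, stepCost (A t) :=
      Finset.sum_le_sum fun t ht => one_le_stepCost (hA t) (hn t (mem_range.1 ht))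
    _ ≤ totalCost A := ENNReal.sum_le_tsum _

theorem stabTime_le_totalCost {A : ℕ → State N} (hA : ∀ t, Odd (A t).card) :
    stabTime A ≤ totalCost A := by
  by_cases h : ∃ t, (A t).card = 1
  · exact (iInf₂_le (Nat.find h) (Nat.find_spec h)).trans
      (natCast_le_totalCost hA fun t ht => Nat.find_min h ht)
  · push Not at h
    have : totalCost A = ⊤ :=
      ENNReal.eq_top_of_forall_nnreal_le fun r => by
        obtain ⟨n, hn⟩ := exists_nat_ge r
        exact le_trans (by exact_mod_cast hn) (natCast_le_totalCost hA (n := n) fun t _ => h t)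
    rw [this]
    exact le_top

end Herman

theorem mainTheorem3 {N : ℕ} [NeZero N] {Ω : Type*} [MeasurableSpace Ω]
    (μ : Measure Ω) [IsProbabilityMeasure μ] (s : ℕ) (A₀ : Herman.State N)
    (hA₀ : A₀.card = 2 * s + 1) (A : ℕ → Ω → Herman.State N) (hA : Herman.IsRun μ A₀ A) :
    (∫⁻ ω, Herman.totalCost (fun t => A t ω) ∂μ ≤
        ENNReal.ofReal ((1 - 1 / (2 * (s : ℝ) + 1) ^ 2) * (N : ℝ) ^ 2 / 6)) ∧
      (∀ᵐ ω ∂μ, Herman.stabTime (fun t => A t ω) ≤ Herman.totalCost (fun t => A t ω)) ∧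
      (∫⁻ ω, Herman.stabTime (fun t => A t ω) ∂μ ≤ ENNReal.ofReal ((N : ℝ) ^ 2 / 6)) := by
  have h₀ : Odd A₀.card := ⟨s, hA₀⟩
  have h1 : ∫⁻ ω, Herman.totalCost (fun t => A t ω) ∂μ ≤
      ENNReal.ofReal ((1 - 1 / (2 * (s : ℝ) + 1) ^ 2) * (N : ℝ) ^ 2 / 6) := by
    refine (hA.lintegral_totalCost_le h₀).trans (ENNReal.ofReal_le_ofReal ?_)
    have := Herman.potential_le h₀
    rw [hA₀] at this
    exact_mod_cast this
  have h2 : ∀ᵐ ω ∂μ, Herman.stabTime (fun t => A t ω) ≤ Herman.totalCost (fun t => A t ω) := by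
    filter_upwards [hA.ae_odd h₀] with ω hω
    exact Herman.stabTime_le_totalCost hω
  refine ⟨h1, h2, (lintegral_mono_ae h2).trans (h1.trans (ENNReal.ofReal_le_ofReal ?_))⟩
  have h3 : (0 : ℝ) ≤ 1 / (2 * (s : ℝ) + 1) ^ 2 := by positivity
  have h4 : (0 : ℝ) ≤ (N : ℝ) ^ 2 := by positivity
  nlinarith [mul_nonneg h3 h4]
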